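/- Let $\mathfrak d\colon\mathbb Z_{>0}\to\mathbb Z_{\ge 0}$ be such that $\mathfrak d(n)\neq 0$ for infinitely many $n$, and put $T_0=0$, $T_n=\sum_{i=1}^n\mathfrak d(i)$. For $n\ge 1$ let $P_n$ be the transition matrix of the simple random walk on the hypercube $\{0,1\}^n$, i.e. $P_n(\vec u,\vec v)=\frac1n$ if $\|\vec u-\vec v\|_1=1$ and $P_n(\vec u,\vec v)=0$ otherwise, and regard $\{0,1\}^n$ as a subset of $\{0,1\}^{n+1}$ by appending a coordinate $0$. Let $X_0,X_1,X_2,\ldots$ be the (time-inhomogeneous) Markov chain with $X_0=\vec 0$ whose transition from $X_t$ to $X_{t+1}$ follows $P_n$ whenever $T_{n-1}\le t<T_n$. Call $\vec 0$ recurrent if $\sum_{t=1}^\infty\Pr[X_t=\vec 0]=\infty$, and transient if $\sum_{t=0}^\infty\Pr[X_t=\vec 0]<\infty$. Then $\vec 0$ is recurrent if and only if $$\sum_{n=1}^\infty\frac{\mathfrak d(n)}{2^n}=\infty ,$$ and $\vec 0$ is transient if and only if this sum is finite. -/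

import Mathlib

open MeasureTheory
open scoped ENNReal

/-- A random walk on a growing graph, i.e. a triple `(𝔡, G, P)` of functions of the phase
`n = 1, 2, 3, …`. All graphs live on subsets of one ambient type `V`, so that `V(n) ⊆ V(n + 1)` and
`E(n) ⊆ E(n + 1)` are inclusions; the matrix `P(n)` is extended by zero outside `V(n) × V(n)`. -/
structure RWoGG (V : Type*) where
  /-- the duration `𝔡(n)` of phase `n`; the value `0` is allowed -/
  duration : ℕ+ → ℕ
  /-- the graph `G(n) = (V(n), E(n))` of phase `n` -/
  graph : ℕ+ → (⊤ : SimpleGraph V).Subgraph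
  /-- the transition matrix `P(n)` of phase `n` -/
  trans : ℕ+ → V → V → ℝ
  finite_verts : ∀ n, (graph n).verts.Finite
  graph_mono : Monotone graph
  trans_nonneg : ∀ n u v, 0 ≤ trans n u v
  trans_supp : ∀ n u v, trans n u v ≠ 0 →
    (u = v ∧ u ∈ (graph n).verts) ∨ (graph n).Adj u v
  trans_sum : ∀ n, ∀ u ∈ (graph n).verts, HasSum (trans n u) 1

namespace RWoGG

variable {V : Type*}

/-- `T_n = 𝔡(1) + ⋯ + 𝔡(n)`, the end of phase `n`; `T_0 = 0`. -/
def T (D : RWoGG V) (n : ℕ) : ℕ := ∑ i ∈ Finset.range n, D.duration i.succPNat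

/-- `X_0, X_1, X_2, …` is a random walk according to `D = (𝔡, G, P)` started at `v`: a Markov chain
whose transition from `X_t` to `X_{t+1}` follows `P(n)` for `t ∈ [T_{n-1}, T_n)`. -/
structure IsWalk (D : RWoGG V) (v : V) {Ω : Type*} [MeasurableSpace Ω] (μ : Measure Ω)
    (X : ℕ → Ω → V) : Prop where
  measurable : ∀ t u, MeasurableSet {ω | X t ω = u}
  init : ∀ᵐ ω ∂μ, X 0 ω = v
  mem_verts : ∀ (n : ℕ+) (t : ℕ), D.T ((n : ℕ) - 1) ≤ t → t ≤ D.T n →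
    ∀ᵐ ω ∂μ, X t ω ∈ (D.graph n).verts
  step : ∀ (n : ℕ+) (t : ℕ), D.T ((n : ℕ) - 1) ≤ t → t < D.T n → ∀ x : ℕ → V,
    μ {ω | ∀ s ≤ t + 1, X s ω = x s} =
      μ {ω | ∀ s ≤ t, X s ω = x s} * ENNReal.ofReal (D.trans n (x t) (x (t + 1)))

end RWoGG

section

variable {V Ω : Type*} [MeasurableSpace Ω]

/-- The return probability `R(t) = Pr[X_t = v]`. -/
def returnProb (μ : Measure Ω) (X : ℕ → Ω → V) (v : V) (t : ℕ) : ℝ≥0∞ := μ {ω | X t ω = v}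

/-- `v` is recurrent: `∑_{t ≥ 1} R(t) = ∞`. -/
def IsRecurrent (μ : Measure Ω) (X : ℕ → Ω → V) (v : V) : Prop :=
  ∑' t : ℕ, returnProb μ X v (t + 1) = ∞

/-- `v` is transient: `∑_{t ≥ 0} R(t) < ∞`. -/
def IsTransient (μ : Measure Ω) (X : ℕ → Ω → V) (v : V) : Prop :=
  ∑' t : ℕ, returnProb μ X v t < ∞

end

namespace Hypercube

/-- Finitely supported 0-1 sequences, the union of all `{0,1}^n`, where `{0,1}^n ⊆ {0,1}^(n+1)` by
appending a zero. -/
abbrev Vertex : Type := ℕ →₀ Fin 2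

/-- `{0,1}^n`: the sequences supported on the first `n` coordinates. -/
def verts (n : ℕ) : Set Vertex := {u | ∀ i, n ≤ i → u i = 0}

/-- `‖u - v‖₁` for `u, v ∈ {0,1}^n`. -/
def l1Dist (n : ℕ) (u v : Vertex) : ℕ :=
  ∑ i ∈ Finset.range n, (((u i : ℕ) : ℤ) - ((v i : ℕ) : ℤ)).natAbs

theorem l1Dist_comm (n : ℕ) (u v : Vertex) : l1Dist n u v = l1Dist n v u :=
  Finset.sum_congr rfl fun _ _ => by omega

/-- The hypercube skeleton `C_n`. -/
def graph (n : ℕ) : (⊤ : SimpleGraph Vertex).Subgraph where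
  verts := verts n
  Adj u v := u ∈ verts n ∧ v ∈ verts n ∧ l1Dist n u v = 1
  adj_sub := by
    rintro u v ⟨-, -, h⟩ rfl
    simp [l1Dist] at h
  edge_vert h := h.1
  symm := ⟨fun u v h => ⟨h.2.1, h.1, l1Dist_comm n u v ▸ h.2.2⟩⟩

open Classical in
/-- The simple random walk on `C_n`: `P_n(u, v) = 1/n` if `‖u - v‖₁ = 1`, and `0` otherwise. -/
noncomputable def trans (n : ℕ) (u v : Vertex) : ℝ :=
  if u ∈ verts n ∧ v ∈ verts n ∧ l1Dist n u v = 1 then 1 / n else 0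

theorem finite_verts (n : ℕ) : (verts n).Finite := by
  have hf : (Set.range fun f : Fin n → Fin 2 => fun i : ℕ =>
      if h : i < n then f ⟨i, h⟩ else 0).Finite := Set.finite_range _
  refine Set.Finite.of_finite_image (f := fun u : Vertex => (u : ℕ → Fin 2))
    (hf.subset ?_) (DFunLike.coe_injective.injOn)
  rintro _ ⟨u, hu, rfl⟩
  refine ⟨fun i => u i, ?_⟩
  funext i
  by_cases h : i < n
  · simp [h]
  · simp [h, hu i (not_lt.1 h)]

theorem l1Dist_eq {m n : ℕ} (hmn : m ≤ n) {u v : Vertex} (hu : u ∈ verts m) (hv : v ∈ verts m) :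
    l1Dist m u v = l1Dist n u v := by
  refine Finset.sum_subset (Finset.range_mono hmn) fun i _ hi => ?_
  have : m ≤ i := by simpa using hi
  simp [hu i this, hv i this]

theorem verts_mono {m n : ℕ} (hmn : m ≤ n) : verts m ⊆ verts n :=
  fun _ hu i hi => hu i (hmn.trans hi)

theorem graph_mono : Monotone graph := fun _ _ hmn =>
  ⟨verts_mono hmn, fun _ _ h =>
    ⟨verts_mono hmn h.1, verts_mono hmn h.2.1, (l1Dist_eq hmn h.1 h.2.1).symm.trans h.2.2⟩⟩

theorem natAbs_sub (a b : Fin 2) :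
    (((a : ℕ) : ℤ) - ((b : ℕ) : ℤ)).natAbs = if b = a then 0 else 1 := by
  revert a b
  decide

theorem adj_iff {n : ℕ} {u : Vertex} (hu : u ∈ verts n) (v : Vertex) :
    (v ∈ verts n ∧ l1Dist n u v = 1) ↔ ∃ i < n, u.update i (1 - u i) = v := by
  have hne : ∀ a : Fin 2, 1 - a ≠ a := by decide
  have hflip : ∀ a b : Fin 2, b ≠ a → 1 - a = b := by decide
  constructor
  · rintro ⟨hv, h⟩
    simp only [l1Dist, natAbs_sub, ← ite_not (p := _ = _), Finset.sum_boole, Nat.cast_id] at h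
    obtain ⟨i, hi⟩ := Finset.card_eq_one.1 h
    have hmem : ∀ j, (j < n ∧ v j ≠ u j) ↔ j = i := fun j => by
      simpa using Finset.ext_iff.1 hi j
    obtain ⟨hin, hvi⟩ := (hmem i).2 rfl
    refine ⟨i, hin, ?_⟩
    ext1 j
    by_cases hj : j = i
    · subst hj
      simpa using hflip _ _ hvi
    · rw [Finsupp.update_apply, if_neg hj]
      by_cases hjn : j < n
      · by_contra hc
        exact hj ((hmem j).1 ⟨hjn, fun h => hc h.symm⟩)
      · rw [hu j (not_lt.1 hjn), hv j (not_lt.1 hjn)]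
  · rintro ⟨i, hin, rfl⟩
    refine ⟨fun j hj => ?_, ?_⟩
    · rw [Finsupp.update_apply, if_neg (by omega), hu j hj]
    · rw [l1Dist, Finset.sum_eq_single_of_mem i (Finset.mem_range.2 hin)]
      · simp [natAbs_sub, hne]
      · intro j _ hj
        simp [Finsupp.update_apply, hj]

theorem trans_sum {n : ℕ} (hn : 0 < n) {u : Vertex} (hu : u ∈ verts n) :
    HasSum (trans n u) 1 := by
  classical
  have hne : ∀ a : Fin 2, 1 - a ≠ a := by decide
  have hinj : Set.InjOn (fun i => u.update i (1 - u i)) (Finset.range n : Set ℕ) := by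
    intro i _ j _ hij
    by_contra hc
    have := DFunLike.congr_fun hij i
    simp [Finsupp.update_apply, hc, hne] at this
  have hs : ∑ v ∈ (Finset.range n).image (fun i => u.update i (1 - u i)), trans n u v = 1 := by
    rw [Finset.sum_image hinj, Finset.sum_congr rfl (g := fun _ => (1 / n : ℝ))]
    · have : (n : ℝ) ≠ 0 := by positivity
      simp [this]
    · intro i hi
      exact if_pos ⟨hu, (adj_iff hu _).2 ⟨i, Finset.mem_range.1 hi, rfl⟩⟩
  rw [← hs]
  refine hasSum_sum_of_ne_finset_zero fun v hv => if_neg fun h => hv ?_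
  obtain ⟨i, hi, rfl⟩ := (adj_iff hu v).1 h.2
  exact Finset.mem_image_of_mem _ (Finset.mem_range.2 hi)

/-- The simple random walk on the growing hypercube with durations `𝔡(1), 𝔡(2), …`. -/
noncomputable def walk (d : ℕ+ → ℕ) : RWoGG Vertex where
  duration := d
  graph n := graph n
  trans n := trans n
  finite_verts n := finite_verts n
  graph_mono _ _ h := graph_mono h
  trans_nonneg n u v := by
    unfold trans
    positivity
  trans_supp n u v h := Or.inr (by
    by_contra hc
    exact h (if_neg hc))
  trans_sum n _ hu := trans_sum n.pos hu

end Hypercube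

/-! Both implications come from comparing the expected number of returns during phase `n` with `𝔡(n)
/ 2^n`, up to summable errors.

Upper bound: every character of `{0,1}^N` is an eigenvector of all the `P_k`, `k ≤ N`, with
eigenvalue `eig k S`. Hence the probability of being at `0` is at most the average over `S` of a
product of `|eig|` (`IsFlipChain.apply_zero_le`). In dimension `k`, only `∅` and the full set have
`|eig| = 1`. They cost `𝔡(k)` each and have weight `2^{-k}`. For the other sets the spectral gap
`2/k` and a sixth moment estimate leave a total of `O(1/k^2)` (`geom_phase_le`,
`sum_phaseBound_le`).

Lower bound: among vertices of the right parity, `0` is the most likely at every time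
(`IsFlipChain.le_apply_zero`), so at even times of phase `n` its probability is at least `2^{-n}`.
About half of the times are even (`IsFlipChain.div_le_sum_apply_zero`). -/

namespace RWoGG

/-! ### One-step law from path probabilities -/

variable {V Ω : Type*} [MeasurableSpace Ω]

/-- The Chapman–Kolmogorov equation for one step of a walk on a growing graph. -/
theorem IsWalk.measure_succ [Countable V] {D : RWoGG V} {v₀ : V} {μ : Measure Ω} {X : ℕ → Ω → V}
    (hX : D.IsWalk v₀ μ X) (n : ℕ+) (t : ℕ) (h₁ : D.T ((n : ℕ) - 1) ≤ t) (h₂ : t < D.T n) (v : V) :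
    μ {ω | X (t + 1) ω = v} = ∑' u, μ {ω | X t ω = u} * ENNReal.ofReal (D.trans n u v) := by
  classical
  let A : (Fin (t + 1) → V) → Set Ω := fun y => {ω | ∀ s : Fin (t + 1), X s ω = y s}
  have hA : ∀ y, MeasurableSet (A y) := fun y => by
    simp only [A, Set.ofPred_forall]
    exact MeasurableSet.iInter fun s => hX.measurable _ _
  have hdisj : Pairwise (Function.onFun Disjoint A) := fun y z hyz =>
    Set.disjoint_left.2 fun ω hy hz => hyz (funext fun s => (hy s).symm.trans (hz s))
  -- The histories up to time `t` form a countable partition, because `V` is countable.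
  have hpart : ∀ B : Set Ω, MeasurableSet B → μ B = ∑' y, μ (A y ∩ B) := fun B hB => by
    rw [← measure_iUnion (fun y z h => (hdisj h).mono Set.inter_subset_left Set.inter_subset_left)
      fun y => (hA y).inter hB, ← Set.iUnion_inter]
    congr 1
    ext ω
    simp only [Set.mem_inter_iff, Set.mem_iUnion]
    exact ⟨fun h => ⟨⟨fun s => X s ω, fun s => rfl⟩, h⟩, fun h => h.2⟩
  have hlast : ∀ y u, μ (A y ∩ {ω | X t ω = u}) = if y (Fin.last t) = u then μ (A y) else 0 := by
    intro y u
    split_ifs with h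
    · congr 1
      refine Set.inter_eq_left.2 fun ω hω => ?_
      have := hω (Fin.last t)
      simpa [h] using this
    · rw [← measure_empty (μ := μ)]
      congr 1
      ext ω
      simp only [Set.mem_inter_iff, Set.mem_empty_iff_false, iff_false]
      rintro ⟨hω, hu⟩
      exact h ((hω (Fin.last t)).symm.trans hu)
  have hstep : ∀ y, μ (A y ∩ {ω | X (t + 1) ω = v}) =
      μ (A y) * ENNReal.ofReal (D.trans n (y (Fin.last t)) v) := by
    intro y
    have := hX.step n t h₁ h₂ fun s => if h : s < t + 1 then y ⟨s, h⟩ else v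
    simp only [lt_add_iff_pos_right, zero_lt_one, dif_pos, lt_irrefl, dif_neg,
      not_false_eq_true] at this
    convert this using 2
    · ext ω
      simp only [A, Set.mem_inter_iff, Set.mem_ofPred_eq]
      constructor
      · rintro ⟨h, h'⟩ s hs
        rcases hs.lt_or_eq with h1 | rfl
        · rw [dif_pos h1]
          exact h ⟨s, h1⟩
        · simpa using h'
      · intro h
        refine ⟨fun s => ?_, by simpa using h (t + 1) le_rfl⟩
        rw [h s s.2.le, dif_pos s.2]
    · congr 1
      ext ω
      simp only [A, Set.mem_ofPred_eq]
      constructor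
      · intro h s hs
        rw [dif_pos (Nat.lt_succ_of_le hs)]
        exact h ⟨s, Nat.lt_succ_of_le hs⟩
      · intro h s
        rw [h s (Nat.le_of_lt_succ s.2), dif_pos s.2]
    · rfl
  rw [hpart _ (hX.measurable _ _)]
  simp_rw [hpart _ (hX.measurable t _), hstep, hlast, ← ENNReal.tsum_mul_right]
  rw [ENNReal.tsum_comm]
  refine tsum_congr fun y => ?_
  rw [tsum_eq_single (y (Fin.last t))]
  · simp
  · intro u hu
    simp [hu.symm]

end RWoGG

namespace Hypercube

/-! ### Coordinate flips and reduction to a recursion for the laws -/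

/-- Flip the `i`-th coordinate. -/
noncomputable def flip (i : ℕ) (u : Vertex) : Vertex := u.update i (1 - u i)

theorem flip_apply (i j : ℕ) (u : Vertex) : flip i u j = if j = i then 1 - u i else u j := by
  rw [flip, Finsupp.update_apply]

theorem flip_flip (i : ℕ) (u : Vertex) : flip i (flip i u) = u := by
  have h : ∀ a : Fin 2, 1 - (1 - a) = a := by decide
  ext1 j
  by_cases hj : j = i <;> simp [flip_apply, hj, h]

theorem flip_comm (i j : ℕ) (u : Vertex) : flip i (flip j u) = flip j (flip i u) := by
  rcases eq_or_ne i j with rfl | hij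
  · rfl
  ext1 k
  rcases eq_or_ne k i with rfl | hi
  · simp [flip_apply, hij]
  rcases eq_or_ne k j with rfl | hj
  · simp [flip_apply, hi]
  · simp [flip_apply, hi, hj]

theorem flip_injective (u : Vertex) : Function.Injective fun i => flip i u := by
  have hne : ∀ a : Fin 2, 1 - a ≠ a := by decide
  intro i j hij
  by_contra hc
  have := DFunLike.congr_fun hij i
  simp [flip_apply, hc, hne] at this

theorem flip_mem_verts {n i : ℕ} (hi : i < n) {u : Vertex} :
    flip i u ∈ verts n ↔ u ∈ verts n := by
  refine forall₂_congr fun j hj => ?_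
  rw [flip_apply, if_neg (by omega)]

theorem trans_flip {n i : ℕ} (hi : i < n) {v : Vertex} (hv : v ∈ verts n) :
    trans n (flip i v) v = 1 / n := by
  have hu := (flip_mem_verts hi).2 hv
  exact if_pos ⟨hu, (adj_iff hu v).2 ⟨i, hi, flip_flip i v⟩⟩

theorem trans_eq_zero {n : ℕ} {u v : Vertex} (h : ∀ i < n, u ≠ flip i v) : trans n u v = 0 := by
  refine if_neg fun hc => ?_
  obtain ⟨i, hi, hiv⟩ := (adj_iff hc.1 v).1 hc.2
  refine h i hi ?_
  rw [← hiv]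
  exact (flip_flip i u).symm

/-- `p t` is a sequence of laws that starts at `0` and in which step `t` flips one of the first
`ν t` coordinates, chosen uniformly. -/
structure IsFlipChain (ν : ℕ → ℕ) (p : ℕ → Vertex → ℝ) : Prop where
  nonneg : ∀ t u, 0 ≤ p t u
  mono : Monotone ν
  pos : ∀ t, 0 < ν t
  init : ∀ u, p 0 u = if u = 0 then 1 else 0
  step : ∀ t v, p (t + 1) v = (∑ i ∈ Finset.range (ν t), p t (flip i v)) / ν t

/-- The phase to which step `t` belongs. -/
noncomputable def phase (d : ℕ+ → ℕ) (hd : ∀ t, ∃ n, t < (walk d).T n) (t : ℕ) : ℕ :=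
  Nat.find (hd t)

theorem T_succ (d : ℕ+ → ℕ) (n : ℕ) : (walk d).T (n + 1) = (walk d).T n + d n.succPNat :=
  Finset.sum_range_succ _ _

theorem T_mono (d : ℕ+ → ℕ) : Monotone (walk d).T :=
  monotone_nat_of_le_succ fun n => by rw [T_succ]; omega

theorem exists_lt_T {d : ℕ+ → ℕ} (hd : {n : ℕ+ | d n ≠ 0}.Infinite) (t : ℕ) :
    ∃ n, t < (walk d).T n := by
  induction t with
  | zero =>
    obtain ⟨m, hm⟩ := hd.nonempty
    refine ⟨m, ?_⟩
    have := T_succ d m.natPred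
    rw [PNat.succPNat_natPred, PNat.natPred_add_one] at this
    have : d m ≠ 0 := hm
    omega
  | succ t ih =>
    obtain ⟨n, hn⟩ := ih
    obtain ⟨m, hm, hnm⟩ := hd.exists_gt n.succPNat
    refine ⟨m, ?_⟩
    have h := T_succ d m.natPred
    rw [PNat.succPNat_natPred, PNat.natPred_add_one] at h
    have h0 : d m ≠ 0 := hm
    have h1 : n ≤ m.natPred := by
      have h2 : n.succ < (m : ℕ) := hnm
      have := PNat.natPred_add_one m
      omega
    have := T_mono d h1
    omega

section

variable {d : ℕ+ → ℕ} {hd : ∀ t, ∃ n, t < (walk d).T n}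

theorem lt_T_phase (t : ℕ) : t < (walk d).T (phase d hd t) := Nat.find_spec (hd t)

theorem phase_le {t n : ℕ} (h : t < (walk d).T n) : phase d hd t ≤ n := Nat.find_min' _ h

theorem phase_mono : Monotone (phase d hd) := fun _ t h => phase_le (h.trans_lt (lt_T_phase t))

theorem phase_pos (t : ℕ) : 0 < phase d hd t := by
  rw [Nat.pos_iff_ne_zero]
  intro h
  have := lt_T_phase (hd := hd) t
  simp [h, RWoGG.T] at this

theorem T_phase_sub_one_le (t : ℕ) : (walk d).T (phase d hd t - 1) ≤ t := by
  by_contra! h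
  have h1 := phase_le (hd := hd) h
  have h2 := phase_pos (hd := hd) t
  omega

theorem phase_eq {n s : ℕ} (hs : s < d n.succPNat) : phase d hd ((walk d).T n + s) = n + 1 := by
  refine le_antisymm (phase_le (by rw [T_succ]; omega)) ?_
  by_contra! h
  have h1 := lt_T_phase (hd := hd) ((walk d).T n + s)
  have h2 := T_mono d (Nat.le_of_lt_succ h)
  omega

variable {Ω : Type*} [MeasurableSpace Ω] {μ : Measure Ω} [IsProbabilityMeasure μ]
  {X : ℕ → Ω → Vertex}

/-- This discards the probability space: all later estimates use only the recursion, plus the total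
mass bound `one_le_sum_measureReal`. -/
theorem isFlipChain_of_isWalk (hX : (walk d).IsWalk 0 μ X) :
    IsFlipChain (phase d hd) fun t u => μ.real {ω | X t ω = u} where
  nonneg _ _ := measureReal_nonneg
  mono := phase_mono
  pos := phase_pos
  init u := by
    split_ifs with h
    · subst h
      rw [measureReal_def, prob_compl_eq_zero_iff (hX.measurable _ _) |>.1 hX.init]
      rfl
    · rw [measureReal_def]
      have : μ {ω | X 0 ω = u} = 0 := by
        refine measure_mono_null (fun ω hω => ?_) hX.init
        simp only [Set.mem_ofPred_eq] at hω
        simp [hω, h]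
      simp [this]
  step t v := by
    set n := phase d hd t with hn
    have hpos : 0 < n := phase_pos t
    have h1 := T_phase_sub_one_le (hd := hd) t
    have h2 := lt_T_phase (hd := hd) t
    have key := hX.measure_succ ⟨n, hpos⟩ t h1 h2 v
    have hsum : μ {ω | X (t + 1) ω = v} = ∑ i ∈ Finset.range n,
        μ {ω | X t ω = flip i v} * ENNReal.ofReal (trans n (flip i v) v) := by
      classical
      rw [key, tsum_eq_sum (s := (Finset.range n).image fun i => flip i v),
        Finset.sum_image (flip_injective v).injOn]
      · rfl
      · intro u hu
        have : trans n u v = 0 := trans_eq_zero fun i hi hc =>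
          hu (Finset.mem_image.2 ⟨i, Finset.mem_range.2 hi, hc.symm⟩)
        change _ * ENNReal.ofReal (trans n u v) = 0
        simp [this]
    change (μ {ω | X (t + 1) ω = v}).toReal = _
    rw [hsum, ENNReal.toReal_sum fun i _ => ENNReal.mul_ne_top (measure_ne_top _ _)
      ENNReal.ofReal_ne_top, Finset.sum_div]
    refine Finset.sum_congr rfl fun i hi => ?_
    have hin := Finset.mem_range.1 hi
    rw [ENNReal.toReal_mul, measureReal_def]
    by_cases hv : v ∈ verts n
    · rw [trans_flip hin hv, ENNReal.toReal_ofReal (by positivity)]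
      ring
    -- The recursion is claimed for every `v`, also outside the current cube. There both sides
    -- vanish, since flipping `i < n` cannot bring `v` back into the cube.
    · have h0 : μ {ω | X t ω = flip i v} = 0 := by
        refine measure_mono_null (fun ω hω => ?_) (hX.mem_verts ⟨n, hpos⟩ t h1 h2.le)
        simp only [Set.mem_ofPred_eq] at hω
        change ¬ X t ω ∈ verts n
        rwa [hω, flip_mem_verts hin]
      simp [h0]

end

end Hypercube

namespace Hypercube

/-! ### Fourier analysis on the hypercube -/

/-- The sign `(-1)^a`. -/
def sign (a : Fin 2) : ℝ := if a = 0 then 1 else -1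

theorem sign_one_sub (a : Fin 2) : sign (1 - a) = -sign a := by
  fin_cases a <;> simp [sign]

/-- The character of the hypercube attached to a finite set of coordinates. -/
noncomputable def char (S : Finset ℕ) (u : Vertex) : ℝ := ∏ i ∈ S, sign (u i)

theorem char_zero (S : Finset ℕ) : char S 0 = 1 := by simp [char, sign]

theorem char_flip (S : Finset ℕ) (i : ℕ) (u : Vertex) :
    char S (flip i u) = (if i ∈ S then -1 else 1) * char S u := by
  have hrest : ∀ s : Finset ℕ, i ∉ s → ∏ j ∈ s, sign (flip i u j) = ∏ j ∈ s, sign (u j) :=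
    fun s hs => Finset.prod_congr rfl fun j hj => by
      rw [flip_apply, if_neg (ne_of_mem_of_not_mem hj hs)]
  split_ifs with h
  · rw [char, char, ← Finset.mul_prod_erase _ _ h, ← Finset.mul_prod_erase S _ h,
      hrest _ (Finset.notMem_erase i S), flip_apply, if_pos rfl, sign_one_sub]
    ring
  · rw [char, hrest _ h, one_mul, char]

/-- The eigenvalue of the simple random walk on `{0,1}^k` for the character attached to `S`. -/
noncomputable def eig (k : ℕ) (S : Finset ℕ) : ℝ := 1 - 2 * (S ∩ Finset.range k).card / k

theorem eig_inter (k : ℕ) (S : Finset ℕ) : eig k (S ∩ Finset.range k) = eig k S := by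
  simp [eig, Finset.inter_assoc]

theorem sum_char_flip {k : ℕ} (hk : 0 < k) (S : Finset ℕ) (u : Vertex) :
    (∑ i ∈ Finset.range k, char S (flip i u)) / k = eig k S * char S u := by
  have h : ∑ i ∈ Finset.range k, (if i ∈ S then (-1 : ℝ) else 1) =
      k - 2 * (S ∩ Finset.range k).card := by
    have : ∀ i, (if i ∈ S then (-1 : ℝ) else 1) = 1 - 2 * if i ∈ S then 1 else 0 := fun i => by
      split_ifs <;> norm_num
    simp_rw [this, Finset.sum_sub_distrib, ← Finset.mul_sum, Finset.sum_boole]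
    rw [Finset.inter_comm, Finset.filter_mem_eq_inter]
    simp
  have hk' : (k : ℝ) ≠ 0 := by positivity
  simp_rw [char_flip, ← Finset.sum_mul, h, eig]
  field_simp

theorem sum_char {N : ℕ} {u : Vertex} (hu : u ∈ verts N) :
    ∑ S ∈ (Finset.range N).powerset, char S u = if u = 0 then 2 ^ N else 0 := by
  simp_rw [char, ← Finset.prod_one_add]
  split_ifs with h
  · subst h
    simp [sign]
    norm_num
  · obtain ⟨i, hi⟩ : ∃ i, u i ≠ 0 := by
      by_contra! hc
      exact h (Finsupp.ext hc)
    refine Finset.prod_eq_zero (i := i) (Finset.mem_range.2 ?_) (by simp [sign, hi])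
    by_contra! hc
    exact hi (hu i hc)

/-- The point mass at `0` is the normalized sum of all characters (`sum_char`), and each step
multiplies the coefficient of `S` by its eigenvalue. A single `N` bounding all dimensions so far
makes one basis serve for every phase. -/
theorem IsFlipChain.eq_sum_char {ν : ℕ → ℕ} {p : ℕ → Vertex → ℝ} (h : IsFlipChain ν p) {N : ℕ} :
    ∀ {t : ℕ}, (∀ s < t, ν s ≤ N) → ∀ {u : Vertex}, u ∈ verts N → p t u =
      (∑ S ∈ (Finset.range N).powerset, (∏ s ∈ Finset.range t, eig (ν s) S) * char S u) / 2 ^ N := by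
  intro t
  induction t with
  | zero =>
    intro _ u hu
    simp only [Finset.range_zero, Finset.prod_empty, one_mul, sum_char hu, h.init]
    split_ifs <;> simp
  | succ t ih =>
    intro ht u hu
    have key : ∀ i ∈ Finset.range (ν t), p t (flip i u) = _ := fun i hi =>
      ih (fun s hs => ht s (by omega))
        ((flip_mem_verts ((Finset.mem_range.1 hi).trans_le (ht t (by omega)))).2 hu)
    rw [h.step, Finset.sum_congr rfl key, ← Finset.sum_div, Finset.sum_comm, div_right_comm,
      Finset.sum_div]
    congr 1
    refine Finset.sum_congr rfl fun S _ => ?_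
    rw [← Finset.mul_sum, mul_div_assoc, sum_char_flip (h.pos t), Finset.prod_range_succ, mul_assoc]

theorem IsFlipChain.apply_zero_le {ν : ℕ → ℕ} {p : ℕ → Vertex → ℝ} (h : IsFlipChain ν p) {N t : ℕ}
    (ht : ∀ s < t, ν s ≤ N) : p t 0 ≤
      (∑ S ∈ (Finset.range N).powerset, ∏ s ∈ Finset.range t, |eig (ν s) S|) / 2 ^ N := by
  rw [h.eq_sum_char ht (u := 0) fun _ _ => rfl]
  gcongr with S
  rw [char_zero, mul_one, ← Finset.abs_prod]
  exact le_abs_self _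

/-- A uniform subset of `{0, …, N - 1}` restricts to a uniform subset of `{0, …, k - 1}`. -/
theorem sum_powerset_inter_range {k N : ℕ} (hkN : k ≤ N) (f : Finset ℕ → ℝ) :
    (∑ S ∈ (Finset.range N).powerset, f (S ∩ Finset.range k)) / 2 ^ N =
      (∑ S ∈ (Finset.range k).powerset, f S) / 2 ^ k := by
  induction N, hkN using Nat.le_induction with
  | base =>
    congr 1
    refine Finset.sum_congr rfl fun S hS => ?_
    rw [Finset.inter_eq_left.2 (Finset.mem_powerset.1 hS)]
  | succ N hkN ih =>
    rw [Finset.range_add_one, Finset.sum_powerset_insert Finset.notMem_range_self, ← ih]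
    have : ∀ S : Finset ℕ, insert N S ∩ Finset.range k = S ∩ Finset.range k := fun S =>
      Finset.insert_inter_of_notMem (by simpa using hkN)
    simp_rw [this]
    rw [pow_succ]
    ring

/-! ### Moments of a sum of `k` random signs -/

/-- For uniform `S`, `k - 2|S|` is a sum of `k` independent signs; this conditions on the last sign
and yields recursions for the moments. -/
theorem sum_powerset_range_succ (k : ℕ) (f : ℝ → ℝ) :
    ∑ S ∈ (Finset.range (k + 1)).powerset, f ((k + 1 : ℕ) - 2 * S.card) =
      ∑ S ∈ (Finset.range k).powerset, (f (k - 2 * S.card + 1) + f (k - 2 * S.card - 1)) := by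
  rw [Finset.range_add_one, Finset.sum_powerset_insert Finset.notMem_range_self,
    ← Finset.sum_add_distrib]
  refine Finset.sum_congr rfl fun S hS => ?_
  rw [Finset.card_insert_of_notMem fun h => by simpa using Finset.mem_powerset.1 hS h]
  push_cast
  congr 2 <;> ring

theorem sum_sq (k : ℕ) :
    ∑ S ∈ (Finset.range k).powerset, ((k : ℝ) - 2 * S.card) ^ 2 = (k : ℝ) * 2 ^ k := by
  induction k with
  | zero => simp
  | succ k ih =>
    rw [sum_powerset_range_succ k (· ^ 2)]
    have : ∀ x : ℝ, (x + 1) ^ 2 + (x - 1) ^ 2 = 2 * x ^ 2 + 2 := fun x => by ring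
    simp only [this, Finset.sum_add_distrib, ← Finset.mul_sum, ih, Finset.sum_const,
      Finset.card_powerset, Finset.card_range, nsmul_eq_mul]
    push_cast
    ring

theorem sum_pow_four (k : ℕ) : ∑ S ∈ (Finset.range k).powerset, ((k : ℝ) - 2 * S.card) ^ 4 =
    (3 * (k : ℝ) ^ 2 - 2 * k) * 2 ^ k := by
  induction k with
  | zero => simp
  | succ k ih =>
    rw [sum_powerset_range_succ k (· ^ 4)]
    have : ∀ x : ℝ, (x + 1) ^ 4 + (x - 1) ^ 4 = 2 * x ^ 4 + 12 * x ^ 2 + 2 := fun x => by ring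
    simp only [this, Finset.sum_add_distrib, ← Finset.mul_sum, ih, sum_sq, Finset.sum_const,
      Finset.card_powerset, Finset.card_range, nsmul_eq_mul]
    push_cast
    ring

theorem sum_pow_six_le (k : ℕ) : ∑ S ∈ (Finset.range k).powerset, ((k : ℝ) - 2 * S.card) ^ 6 ≤
    15 * (k : ℝ) ^ 3 * 2 ^ k := by
  induction k with
  | zero => simp
  | succ k ih =>
    rw [sum_powerset_range_succ k (· ^ 6)]
    have : ∀ x : ℝ, (x + 1) ^ 6 + (x - 1) ^ 6 = 2 * x ^ 6 + 30 * x ^ 4 + 30 * x ^ 2 + 2 :=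
      fun x => by ring
    simp only [this, Finset.sum_add_distrib, ← Finset.mul_sum, sum_sq, sum_pow_four,
      Finset.sum_const, Finset.card_powerset, Finset.card_range, nsmul_eq_mul]
    push_cast
    -- This is exactly the slack in the inductive step.
    have h : 0 ≤ (120 * k + 28 : ℝ) * 2 ^ k := by positivity
    rw [pow_succ (2 : ℝ)]
    linarith

theorem sum_eig_pow_six_le {k : ℕ} (hk : 0 < k) :
    (∑ S ∈ (Finset.range k).powerset, eig k S ^ 6) / 2 ^ k ≤ 15 / k ^ 3 := by
  have hk' : (0 : ℝ) < k := by positivity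
  have h : ∑ S ∈ (Finset.range k).powerset, eig k S ^ 6 =
      (∑ S ∈ (Finset.range k).powerset, ((k : ℝ) - 2 * S.card) ^ 6) / k ^ 6 := by
    rw [Finset.sum_div]
    refine Finset.sum_congr rfl fun S hS => ?_
    rw [eig, Finset.inter_eq_left.2 (Finset.mem_powerset.1 hS), ← div_pow]
    congr 1
    field_simp
  rw [h, div_div, div_le_div_iff₀ (by positivity) (by positivity)]
  calc _ ≤ 15 * (k : ℝ) ^ 3 * 2 ^ k * k ^ 3 := by gcongr; exact sum_pow_six_le k
    _ = _ := by ring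

/-! ### Spectral gap and the cost of one phase -/

/-- The eigenvalues of the simple random walk on `{0,1}^k` other than `1` and `-1` are at distance
at least `2 / k` from these. -/
theorem abs_eig_le {k : ℕ} (hk : 0 < k) {S : Finset ℕ} (hS : S ⊆ Finset.range k) (h0 : S ≠ ∅)
    (h1 : S ≠ Finset.range k) : |eig k S| ≤ 1 - 2 / k := by
  have hk' : (0 : ℝ) < k := by positivity
  have hpos : (1 : ℝ) ≤ S.card := by
    exact_mod_cast Finset.card_pos.2 (Finset.nonempty_iff_ne_empty.2 h0)
  have hlt : (S.card : ℝ) + 1 ≤ k := by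
    have := Finset.card_lt_card (Finset.ssubset_iff_subset_ne.2 ⟨hS, h1⟩)
    rw [Finset.card_range] at this
    exact_mod_cast this
  rw [eig, Finset.inter_eq_left.2 hS, abs_le]
  constructor
  · rw [← sub_nonneg]
    have : 1 - 2 * (S.card : ℝ) / k - -(1 - 2 / k) = 2 * (k - 1 - S.card) / k := by
      field_simp
      ring
    rw [this]
    exact div_nonneg (by linarith) hk'.le
  · gcongr
    linarith

theorem abs_eig_le_one {k : ℕ} (hk : 0 < k) (S : Finset ℕ) : |eig k S| ≤ 1 := by
  have hk' : (0 : ℝ) < k := by positivity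
  have : ((S ∩ Finset.range k).card : ℝ) ≤ k := by
    exact_mod_cast (Finset.card_le_card Finset.inter_subset_right).trans_eq (Finset.card_range k)
  have h1 : ((S ∩ Finset.range k).card : ℝ) / k ≤ 1 := (div_le_one hk').2 this
  have h2 : 0 ≤ ((S ∩ Finset.range k).card : ℝ) / k := by positivity
  rw [eig, abs_le, mul_div_assoc]
  constructor <;> linarith

/-- The number of times that a phase of length `m` in dimension `k` may contribute to the return
probabilities through the character attached to `S`. -/
noncomputable def phaseBound (m k : ℕ) (S : Finset ℕ) : ℝ :=
  (m * if S = ∅ then 1 else 0) + (m * if S = Finset.range k then 1 else 0) + 32 * k * eig k S ^ 6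

/-- The sixth power is the first even one that suffices: the factor `k` from the gap times a sixth
moment of order `k^{-3}` is summable, while a fourth moment would only give order `1/k`. -/
theorem sum_phaseBound_le {m k : ℕ} (hk : 0 < k) :
    (∑ S ∈ (Finset.range k).powerset, phaseBound m k S) / 2 ^ k ≤
      2 * (m / 2 ^ k) + 480 / k ^ 2 := by
  have hk' : (0 : ℝ) < k := by positivity
  simp only [phaseBound, Finset.sum_add_distrib, ← Finset.mul_sum, Finset.sum_ite_eq',
    Finset.mem_powerset, Finset.empty_subset, subset_refl, if_true, add_div, mul_one]
  have h := mul_le_mul_of_nonneg_left (sum_eig_pow_six_le hk) (by positivity : (0 : ℝ) ≤ 32 * k)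
  have h' : 32 * (k : ℝ) * (15 / k ^ 3) = 480 / k ^ 2 := by
    field_simp
    norm_num
  rw [mul_div_assoc (32 * (k : ℝ))]
  linarith

/-- Keeping the surviving weight `x^m` on the left lets a small eigenvalue pay for its phase by the
weight it destroys. With `G` the geometric sum, the left side is `1 + G(2x - 1)`, so there is no
excess when `x ≤ 1/2`. When `x ≥ 1/2`, the gap gives `G ≤ k/2`, and `64 x^6 ≥ 1` turns this into `32
k x^6`. -/
theorem geom_phase_le {k : ℕ} (hk : 0 < k) (m : ℕ) {S : Finset ℕ} (hS : S ⊆ Finset.range k) :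
    ∑ s ∈ Finset.range m, |eig k S| ^ (s + 1) + |eig k S| ^ m ≤ 1 + phaseBound m k S := by
  have hk' : (0 : ℝ) < k := by positivity
  set x := |eig k S| with hx
  have hx0 : 0 ≤ x := abs_nonneg _
  have hx1 : x ≤ 1 := abs_eig_le_one hk S
  have hx6 : eig k S ^ 6 = x ^ 6 := by rw [hx, Even.pow_abs ⟨3, rfl⟩]
  have hb : 0 ≤ 32 * (k : ℝ) * eig k S ^ 6 := by rw [hx6]; positivity
  have htriv : ∑ s ∈ Finset.range m, x ^ (s + 1) + x ^ m ≤ m + 1 := by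
    refine add_le_add ?_ (pow_le_one₀ hx0 hx1)
    calc _ ≤ ∑ s ∈ Finset.range m, (1 : ℝ) := Finset.sum_le_sum fun s _ => pow_le_one₀ hx0 hx1
      _ = m := by simp
  have ha : ∀ c : Prop, ∀ [Decidable c], 0 ≤ (m : ℝ) * if c then 1 else 0 := fun c _ => by
    positivity
  by_cases h0 : S = ∅
  · have := ha (S = Finset.range k)
    rw [phaseBound, if_pos h0]
    linarith
  by_cases h1 : S = Finset.range k
  · have := ha (S = ∅)
    rw [phaseBound, if_pos h1]
    linarith
  rw [phaseBound, if_neg h0, if_neg h1, mul_zero, add_zero, zero_add, hx6]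
  have hgap : x ≤ 1 - 2 / k := abs_eig_le hk hS h0 h1
  have hk2 : 0 < 2 / (k : ℝ) := by positivity
  have hgeom : (∑ s ∈ Finset.range m, x ^ s) * (1 - x) = 1 - x ^ m := by
    have := geom_sum_mul x m
    linarith
  have hsum : ∑ s ∈ Finset.range m, x ^ (s + 1) = x * ∑ s ∈ Finset.range m, x ^ s := by
    rw [Finset.mul_sum]
    exact Finset.sum_congr rfl fun s _ => pow_succ' x s
  rw [hsum]
  set G := ∑ s ∈ Finset.range m, x ^ s
  have hG : 0 ≤ G := Finset.sum_nonneg fun s _ => pow_nonneg hx0 s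
  have hxm : 0 ≤ x ^ m := pow_nonneg hx0 m
  rcases le_total x (1 / 2) with hh | hh
  · have : 0 ≤ 32 * (k : ℝ) * x ^ 6 := by positivity
    nlinarith
  · have hGk : G ≤ k / 2 := by
      have : G * (2 / k) ≤ 1 := by nlinarith
      rwa [← le_div_iff₀ hk2, one_div_div] at this
    have h64 : (1 : ℝ) ≤ 64 * x ^ 6 := by
      have := pow_le_pow_left₀ (by norm_num) hh 6
      norm_num at this
      linarith
    have h1 : G * 1 ≤ k / 2 * (64 * x ^ 6) := by gcongr
    have h2 : x * G + x ^ m = G * (2 * x - 1) + 1 := by linarith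
    nlinarith

end Hypercube

namespace Hypercube

theorem phaseBound_nonneg (m k : ℕ) (S : Finset ℕ) : 0 ≤ phaseBound m k S := by
  have : 0 ≤ eig k S ^ 6 := Even.pow_nonneg ⟨3, rfl⟩ _
  unfold phaseBound
  positivity

/-! ### Upper bound over all phases -/

section

variable {d : ℕ+ → ℕ} {hd : ∀ t, ∃ n, t < (walk d).T n}

/-- The trailing product is the weight left after `N` phases. It serves as a potential: the next
phase multiplies it by at most `1 + phaseBound`, counting that phase's own terms, and it never
exceeds `1`. -/
theorem sum_prod_abs_eig_le (S : Finset ℕ) (N : ℕ) :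
    ∑ t ∈ Finset.range ((walk d).T N), ∏ s ∈ Finset.range (t + 1), |eig (phase d hd s) S| +
        ∏ s ∈ Finset.range ((walk d).T N), |eig (phase d hd s) S| ≤
      1 + ∑ n ∈ Finset.range N,
        phaseBound (d n.succPNat) (n + 1) (S ∩ Finset.range (n + 1)) := by
  induction N with
  | zero => simp [RWoGG.T]
  | succ n ih =>
    set W := ∏ s ∈ Finset.range ((walk d).T n), |eig (phase d hd s) S|
    have hprod : ∀ m ≤ d n.succPNat,
        ∏ s ∈ Finset.range ((walk d).T n + m), |eig (phase d hd s) S| =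
          W * |eig (n + 1) (S ∩ Finset.range (n + 1))| ^ m := fun m hm => by
      have hconst : ∀ s ∈ Finset.range m,
          |eig (phase d hd ((walk d).T n + s)) S| = |eig (n + 1) S| := fun s hs => by
        rw [phase_eq ((Finset.mem_range.1 hs).trans_le hm)]
      rw [Finset.prod_range_add, Finset.prod_congr rfl hconst, Finset.prod_const,
        Finset.card_range, eig_inter]
    have hW0 : 0 ≤ W := Finset.prod_nonneg fun _ _ => abs_nonneg _
    have hW1 : W ≤ 1 := Finset.prod_le_one (fun _ _ => abs_nonneg _) fun s _ =>
      abs_eig_le_one (phase_pos s) S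
    have hphase : ∀ s ∈ Finset.range (d n.succPNat),
        ∏ r ∈ Finset.range ((walk d).T n + s + 1), |eig (phase d hd r) S| =
          W * |eig (n + 1) (S ∩ Finset.range (n + 1))| ^ (s + 1) := fun s hs => by
      rw [add_assoc, hprod _ (Finset.mem_range.1 hs)]
    rw [T_succ, Finset.sum_range_add, hprod _ le_rfl, Finset.sum_congr rfl hphase,
      ← Finset.mul_sum, Finset.sum_range_succ _ n]
    have hgeom := geom_phase_le n.succ_pos (d n.succPNat)
      (Finset.inter_subset_right (s₁ := S) (s₂ := Finset.range (n + 1)))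
    have hB := phaseBound_nonneg (d n.succPNat) (n + 1) (S ∩ Finset.range (n + 1))
    have h1 := mul_le_mul_of_nonneg_left hgeom hW0
    have h2 := mul_le_mul_of_nonneg_right hW1 hB
    simp only [Nat.succ_eq_add_one] at h1
    linarith

theorem IsFlipChain.sum_apply_zero_le {p : ℕ → Vertex → ℝ} (h : IsFlipChain (phase d hd) p)
    (N : ℕ) : ∑ t ∈ Finset.range ((walk d).T N), p (t + 1) 0 ≤
      1 + ∑ n ∈ Finset.range N,
        (2 * ((d n.succPNat : ℝ) / 2 ^ (n + 1)) + 480 / (n + 1 : ℕ) ^ 2) := by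
  calc _ ≤ ∑ t ∈ Finset.range ((walk d).T N), (∑ S ∈ (Finset.range N).powerset,
        ∏ s ∈ Finset.range (t + 1), |eig (phase d hd s) S|) / 2 ^ N :=
      Finset.sum_le_sum fun t ht => h.apply_zero_le fun s hs =>
        phase_le ((Nat.le_of_lt_succ hs).trans_lt (Finset.mem_range.1 ht))
    _ = (∑ S ∈ (Finset.range N).powerset, ∑ t ∈ Finset.range ((walk d).T N),
        ∏ s ∈ Finset.range (t + 1), |eig (phase d hd s) S|) / 2 ^ N := by
      rw [← Finset.sum_div, Finset.sum_comm]
    _ ≤ (∑ S ∈ (Finset.range N).powerset, (1 + ∑ n ∈ Finset.range N,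
        phaseBound (d n.succPNat) (n + 1) (S ∩ Finset.range (n + 1)))) / 2 ^ N := by
      gcongr with S
      refine le_trans (le_add_of_nonneg_right ?_) (sum_prod_abs_eig_le (hd := hd) S N)
      exact Finset.prod_nonneg fun _ _ => abs_nonneg _
    _ = 1 + ∑ n ∈ Finset.range N, (∑ S ∈ (Finset.range N).powerset,
        phaseBound (d n.succPNat) (n + 1) (S ∩ Finset.range (n + 1))) / 2 ^ N := by
      rw [Finset.sum_add_distrib, add_div, Finset.sum_comm, ← Finset.sum_div]
      simp
    _ ≤ _ := by
      gcongr with n hn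
      rw [sum_powerset_inter_range (Finset.mem_range.1 hn)]
      exact sum_phaseBound_le n.succ_pos

end

/-! ### Lower bound at even times -/

section LowerBound

variable {ν : ℕ → ℕ} {p : ℕ → Vertex → ℝ}

theorem IsFlipChain.eq_zero_of_notMem_verts (h : IsFlipChain ν p) {N : ℕ} :
    ∀ {t : ℕ}, (∀ s < t, ν s ≤ N) → ∀ {u : Vertex}, u ∉ verts N → p t u = 0 := by
  intro t
  induction t with
  | zero =>
    intro _ u hu
    rw [h.init, if_neg]
    rintro rfl
    exact hu fun _ _ => rfl
  | succ t ih =>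
    intro ht u hu
    rw [h.step, Finset.sum_eq_zero, zero_div]
    intro i hi
    refine ih (fun s hs => ht s (by omega)) ?_
    rwa [flip_mem_verts ((Finset.mem_range.1 hi).trans_le (ht t (by omega)))]

/-- Flipping two zeros to ones does not increase the probability. -/
theorem IsFlipChain.flip_flip_le (h : IsFlipChain ν p) (t : ℕ) {i j : ℕ} (hij : i ≠ j) :
    ∀ {u : Vertex}, u i = 0 → u j = 0 → p t (flip i (flip j u)) ≤ p t u := by
  induction t with
  | zero =>
    intro u hi hj
    rw [h.init, if_neg, h.init]
    · split_ifs <;> norm_num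
    · intro hc
      have := DFunLike.congr_fun hc i
      simp [flip_apply, hij, hi] at this
  | succ t ih =>
    intro u hi hj
    have hother : ∀ k, k ≠ i → k ≠ j →
        p t (flip k (flip i (flip j u))) ≤ p t (flip k u) := fun k hki hkj => by
      rw [flip_comm k i, flip_comm k j]
      apply ih <;> simp [flip_apply, Ne.symm hki, Ne.symm hkj, hi, hj]
    -- If both coordinates are active, the terms for flips at `i` and `j` are the same two on both
    -- sides, swapped; the remaining terms compare by induction. Otherwise the vertex with both ones
    -- is not yet reachable.
    by_cases hmem : i < ν t ∧ j < ν t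
    · rw [h.step, h.step]
      gcongr ?_ / _
      have hji : j ∈ (Finset.range (ν t)).erase i :=
        Finset.mem_erase.2 ⟨hij.symm, Finset.mem_range.2 hmem.2⟩
      rw [← Finset.add_sum_erase _ _ (Finset.mem_range.2 hmem.1), ← Finset.add_sum_erase _ _ hji,
        ← Finset.add_sum_erase _ (fun k => p t (flip k u)) (Finset.mem_range.2 hmem.1),
        ← Finset.add_sum_erase _ _ hji, flip_flip, flip_comm i j, flip_flip]
      have : ∑ k ∈ ((Finset.range (ν t)).erase i).erase j, p t (flip k (flip j (flip i u))) ≤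
          ∑ k ∈ ((Finset.range (ν t)).erase i).erase j, p t (flip k u) := by
        refine Finset.sum_le_sum fun k hk => ?_
        simp only [Finset.mem_erase] at hk
        rw [flip_comm j i]
        exact hother k hk.2.1 hk.1
      linarith
    · refine le_of_eq_of_le (h.eq_zero_of_notMem_verts (N := ν t)
        (fun s hs => h.mono (Nat.le_of_lt_succ hs)) fun hc => hmem ⟨?_, ?_⟩) (h.nonneg _ _)
      · by_contra! hlt
        have := hc i hlt
        simp [flip_apply, hij, hi] at this
      · by_contra! hlt
        have := hc j hlt
        simp [flip_apply, hij.symm, hj] at this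

/-- The full character is the parity of the number of ones, and every step changes it. -/
theorem IsFlipChain.char_eq (h : IsFlipChain ν p) {N : ℕ} :
    ∀ {t : ℕ}, (∀ s < t, ν s ≤ N) → ∀ {u : Vertex}, p t u ≠ 0 →
      char (Finset.range N) u = (-1) ^ t := by
  intro t
  induction t with
  | zero =>
    intro _ u hu
    rw [h.init] at hu
    have : u = 0 := by
      by_contra hc
      simp [hc] at hu
    rw [this, char_zero, pow_zero]
  | succ t ih =>
    intro ht u hu
    rw [h.step] at hu
    obtain ⟨i, hi, hne⟩ := Finset.exists_ne_zero_of_sum_ne_zero (div_ne_zero_iff.1 hu).1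
    have := ih (fun s hs => ht s (by omega)) hne
    rw [char_flip, if_pos (Finset.mem_range.2 ((Finset.mem_range.1 hi).trans_le
      (ht t (by omega))))] at this
    rw [pow_succ, ← this]
    ring

/-- A vertex of even weight reaches `0` by erasing ones in pairs, and `flip_flip_le` applies to each
pair. Induction on the bound `m` for the weight. -/
theorem IsFlipChain.le_apply_zero (h : IsFlipChain ν p) (t : ℕ) {N : ℕ} (m : ℕ) :
    ∀ {u : Vertex}, u.support.card ≤ m → u ∈ verts N → char (Finset.range N) u = 1 →
      p t u ≤ p t 0 := by
  have hone : ∀ a : Fin 2, a ≠ 0 → 1 - a = 0 := by decide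
  have hlt : ∀ (i : ℕ) (u : Vertex), u i ≠ 0 → (flip i u).support = u.support.erase i := by
    intro i u hi
    ext k
    by_cases hk : k = i
    · subst hk
      simp [flip_apply, hone _ hi]
    · simp [flip_apply, hk]
  induction m with
  | zero =>
    intro u hu _ _
    rw [Finsupp.support_eq_empty.1 (Finset.card_eq_zero.1 (Nat.le_zero.1 hu))]
  | succ m ih =>
    intro u hu hN hchar
    rcases eq_or_ne u 0 with rfl | hu0
    · rfl
    have hrange : ∀ i, u i ≠ 0 → i < N := fun i hi => by
      by_contra! hc
      exact hi (hN i hc)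
    obtain ⟨i, hi⟩ := Finsupp.ne_iff.1 hu0
    rw [Finsupp.coe_zero, Pi.zero_apply] at hi
    have hiN := hrange i hi
    have hchari : char (Finset.range N) (flip i u) = -1 := by
      rw [char_flip, if_pos (Finset.mem_range.2 hiN), hchar, mul_one]
    -- Parity supplies a second one: after erasing the first, the character is `-1`, so the vertex
    -- is not `0`.
    obtain ⟨j, hj⟩ : ∃ j, flip i u j ≠ 0 := by
      by_contra! hc
      have h0 : flip i u = 0 := Finsupp.ext hc
      rw [h0, char_zero] at hchari
      norm_num at hchari
    have hji : j ≠ i := by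
      rintro rfl
      exact hj (by rw [flip_apply, if_pos rfl, hone _ hi])
    have huj : u j ≠ 0 := by rwa [flip_apply, if_neg hji] at hj
    have hjN := hrange j huj
    refine le_trans ?_ (ih (u := flip j (flip i u)) ?_ ?_ ?_)
    · have := h.flip_flip_le t hji.symm (u := flip j (flip i u))
        (by rw [flip_apply, if_neg hji.symm, flip_apply, if_pos rfl, hone _ hi])
        (by rw [flip_apply, if_pos rfl, hone _ hj])
      rwa [flip_flip, flip_flip] at this
    · rw [hlt j _ hj, hlt i _ hi]
      have h1 := Finset.card_erase_lt_of_mem (Finsupp.mem_support_iff.2 hi)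
      have h2 := Finset.card_erase_le (s := u.support.erase i) (a := j)
      omega
    · rwa [flip_mem_verts hjN, flip_mem_verts hiN]
    · rw [char_flip, if_pos (Finset.mem_range.2 hjN), hchari]
      norm_num

theorem card_verts_le (n : ℕ) : (finite_verts n).toFinset.card ≤ 2 ^ n := by
  rw [← Finset.card_range n, ← Finset.card_powerset, Finset.card_range]
  refine Finset.card_le_card_of_injOn (fun u => u.support) ?_ ?_
  · intro u hu
    have hu' : u ∈ verts n := by simpa using hu
    simp only [Finset.coe_powerset, Set.mem_preimage, Set.mem_powerset_iff, Finset.coe_subset]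
    intro i hi
    rw [Finset.mem_range]
    by_contra! hc
    exact Finsupp.mem_support_iff.1 hi (hu' i hc)
  · have htwo : ∀ a b : Fin 2, (a ≠ 0 ↔ b ≠ 0) → a = b := by decide
    intro u _ v _ huv
    refine Finsupp.ext fun i => htwo _ _ ?_
    rw [← Finsupp.mem_support_iff, ← Finsupp.mem_support_iff]
    exact Finset.ext_iff.1 huv i

theorem IsFlipChain.le_apply_zero_of_even (h : IsFlipChain ν p) {t n : ℕ} (ht : Even t)
    (hn : ∀ s < t, ν s ≤ n) (hsum : 1 ≤ ∑ u ∈ (finite_verts n).toFinset, p t u) :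
    1 / 2 ^ n ≤ p t 0 := by
  have hle : ∀ u ∈ (finite_verts n).toFinset, p t u ≤ p t 0 := fun u hu => by
    by_cases h0 : p t u = 0
    · rw [h0]
      exact h.nonneg t 0
    · exact h.le_apply_zero t _ le_rfl (by simpa using hu) ((h.char_eq hn h0).trans ht.neg_one_pow)
  rw [div_le_iff₀' (by positivity)]
  calc 1 ≤ _ := hsum
    _ ≤ (finite_verts n).toFinset.card • p t 0 := Finset.sum_le_card_nsmul _ _ _ hle
    _ ≤ 2 ^ n * p t 0 := by
      rw [nsmul_eq_mul]
      gcongr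
      · exact h.nonneg t 0
      · exact_mod_cast card_verts_le n

end LowerBound

/-! ### Summing the lower bound and comparing the series -/

section

variable {d : ℕ+ → ℕ} {hd : ∀ t, ∃ n, t < (walk d).T n}

theorem IsFlipChain.div_le_sum_apply_zero {p : ℕ → Vertex → ℝ} (h : IsFlipChain (phase d hd) p)
    (hsum : ∀ t, 1 ≤ ∑ u ∈ (finite_verts (phase d hd t)).toFinset, p (t + 1) u) (N : ℕ) :
    ∑ n ∈ Finset.range N, (d n.succPNat : ℝ) / 2 ^ (n + 1) ≤
      2 * ∑ t ∈ Finset.range ((walk d).T N), p (t + 1) 0 +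
        ∑ n ∈ Finset.range N, (1 / 2) ^ (n + 1) := by
  induction N with
  | zero => simp [RWoGG.T]
  | succ n ih =>
    rw [Finset.sum_range_succ, T_succ, Finset.sum_range_add, Finset.sum_range_succ]
    set m := d n.succPNat
    set T := (walk d).T n
    -- The factor `1 + (-1)^(T+s+1)` is `2` at even times and `0` at odd ones, so both parities are
    -- covered by one inequality.
    have hterm : ∀ s ∈ Finset.range m,
        1 / 2 ^ (n + 1) * (1 + (-1) ^ (T + 1) * (-1) ^ s) ≤ 2 * p (T + s + 1) 0 := fun s hs => by
      have hph : phase d hd (T + s) = n + 1 := phase_eq (Finset.mem_range.1 hs)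
      have hs1 := hsum (T + s)
      rw [hph] at hs1
      have hpow : (-1 : ℝ) ^ (T + 1) * (-1) ^ s = (-1) ^ (T + s + 1) := by ring
      rw [hpow]
      rcases Nat.even_or_odd (T + s + 1) with he | ho
      · rw [he.neg_one_pow]
        have := h.le_apply_zero_of_even he
          (fun r hr => hph ▸ phase_mono (Nat.le_of_lt_succ hr)) hs1
        linarith
      · rw [ho.neg_one_pow]
        have := h.nonneg (T + s + 1) 0
        linarith
    have hS := Finset.sum_le_sum hterm
    rw [← Finset.mul_sum, Finset.sum_add_distrib, ← Finset.mul_sum, neg_one_geom_sum,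
      ← Finset.mul_sum] at hS
    simp only [Finset.sum_const, Finset.card_range, nsmul_eq_mul, mul_one] at hS
    -- The alternating sum costs at most `1` per phase, whence the geometric error term.
    have hlow : (m : ℝ) - 1 ≤ m + (-1) ^ (T + 1) * if Even m then 0 else 1 := by
      rcases neg_one_pow_eq_or ℝ (T + 1) with h1 | h1 <;> rw [h1] <;> split_ifs <;> linarith
    have h2 : (0 : ℝ) ≤ 1 / 2 ^ (n + 1) := by positivity
    have h3 := mul_le_mul_of_nonneg_left hlow h2
    have h4 : ((1 : ℝ) / 2) ^ (n + 1) = 1 / 2 ^ (n + 1) := by rw [div_pow, one_pow]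
    rw [h4, div_eq_mul_one_div (m : ℝ)]
    linarith

variable {Ω : Type*} [MeasurableSpace Ω] {μ : Measure Ω} [IsProbabilityMeasure μ]
  {X : ℕ → Ω → Vertex}

theorem one_le_sum_measureReal (hX : (walk d).IsWalk 0 μ X) (t : ℕ) :
    1 ≤ ∑ u ∈ (finite_verts (phase d hd t)).toFinset, μ.real {ω | X (t + 1) ω = u} := by
  have hmem := hX.mem_verts ⟨_, phase_pos (hd := hd) t⟩ (t + 1)
    ((T_phase_sub_one_le t).trans t.le_succ) (lt_T_phase t)
  have hunion : μ (⋃ u ∈ (finite_verts (phase d hd t)).toFinset, {ω | X (t + 1) ω = u}) = 1 := by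
    rw [← prob_compl_eq_zero_iff (Finset.measurableSet_biUnion _ fun u _ => hX.measurable _ u)]
    refine mem_ae_iff.1 ?_
    filter_upwards [hmem] with ω hω
    have hω' : X (t + 1) ω ∈ verts (phase d hd t) := hω
    simpa using hω'
  have hle := measure_biUnion_finset_le (μ := μ) (finite_verts (phase d hd t)).toFinset
    fun u => {ω | X (t + 1) ω = u}
  rw [hunion] at hle
  have := ENNReal.toReal_mono (ENNReal.sum_ne_top.2 fun u _ => measure_ne_top _ _) hle
  rwa [ENNReal.toReal_sum fun u _ => measure_ne_top _ _] at this

theorem summable_returnProb_iff (hd : ∀ t, ∃ n, t < (walk d).T n)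
    (hX : (walk d).IsWalk 0 μ X) :
    (Summable fun t => μ.real {ω | X (t + 1) ω = 0}) ↔
      Summable fun n : ℕ => (d n.succPNat : ℝ) / 2 ^ (n + 1) := by
  have hchain := isFlipChain_of_isWalk (hd := hd) hX
  have hgeom : Summable fun n : ℕ => ((1 : ℝ) / 2) ^ (n + 1) :=
    (summable_nat_add_iff 1).2 summable_geometric_two
  have hsq : Summable fun n : ℕ => (480 : ℝ) / (n + 1 : ℕ) ^ 2 := by
    refine (summable_nat_add_iff (f := fun n : ℕ => (480 : ℝ) / (n : ℝ) ^ 2) 1).2 ?_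
    simpa [div_eq_mul_inv] using (Real.summable_nat_pow_inv.2 one_lt_two).mul_left (480 : ℝ)
  have hp : ∀ t, 0 ≤ μ.real {ω | X (t + 1) ω = 0} := fun t => measureReal_nonneg
  have hq : ∀ n : ℕ, 0 ≤ (d n.succPNat : ℝ) / 2 ^ (n + 1) := fun n => by positivity
  constructor
  · intro h
    refine summable_of_sum_range_le hq fun N => (hchain.div_le_sum_apply_zero
      (one_le_sum_measureReal hX) N).trans (add_le_add (mul_le_mul_of_nonneg_left
        (h.sum_le_tsum _ fun t _ => hp t) zero_le_two)
        (hgeom.sum_le_tsum _ fun n _ => by positivity))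
  · intro h
    have hs := (h.mul_left 2).add hsq
    refine summable_of_sum_range_le (c := 1 + ∑' n : ℕ, (2 * ((d n.succPNat : ℝ) / 2 ^ (n + 1)) +
      480 / (n + 1 : ℕ) ^ 2)) hp fun t => ?_
    obtain ⟨N, hN⟩ := hd t
    calc _ ≤ ∑ s ∈ Finset.range ((walk d).T N), μ.real {ω | X (s + 1) ω = 0} :=
        Finset.sum_le_sum_of_subset_of_nonneg (Finset.range_mono hN.le) fun s _ _ => hp s
      _ ≤ _ := hchain.sum_apply_zero_le N
      _ ≤ _ := add_le_add_right (hs.sum_le_tsum _ fun n _ =>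
        add_nonneg (mul_nonneg zero_le_two (hq n)) (by positivity)) 1

end

theorem tsum_ofReal_eq_top_iff {f : ℕ → ℝ} (hf : ∀ n, 0 ≤ f n) :
    ∑' n, ENNReal.ofReal (f n) = ∞ ↔ ¬ Summable f := by
  refine ⟨fun h hs => hs.tsum_ofReal_ne_top h, fun h => ?_⟩
  by_contra hc
  refine h ((ENNReal.summable_toReal hc).congr fun n => ?_)
  rw [ENNReal.toReal_ofReal (hf n)]

end Hypercube

theorem theorem5p5 (d : ℕ+ → ℕ) (hd : {n : ℕ+ | d n ≠ 0}.Infinite)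
    {Ω : Type*} [MeasurableSpace Ω] (μ : Measure Ω) [IsProbabilityMeasure μ]
    (X : ℕ → Ω → Hypercube.Vertex) (hX : (Hypercube.walk d).IsWalk 0 μ X) :
    (IsRecurrent μ X 0 ↔ ∑' n : ℕ+, (d n : ℝ≥0∞) / 2 ^ (n : ℕ) = ∞) ∧
      (IsTransient μ X 0 ↔ ∑' n : ℕ+, (d n : ℝ≥0∞) / 2 ^ (n : ℕ) < ∞) := by
  have hret : ∀ t, returnProb μ X 0 t = ENNReal.ofReal (μ.real {ω | X t ω = 0}) := fun t =>
    (ENNReal.ofReal_toReal (measure_ne_top _ _)).symm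
  have hdiv : ∀ n : ℕ, (d n.succPNat : ℝ≥0∞) / 2 ^ (n + 1) =
      ENNReal.ofReal ((d n.succPNat : ℝ) / 2 ^ (n + 1)) := fun n => by
    rw [ENNReal.ofReal_div_of_pos (by positivity), ENNReal.ofReal_natCast,
      ENNReal.ofReal_pow zero_le_two, ENNReal.ofReal_ofNat]
  have hsum : ∑' n : ℕ+, (d n : ℝ≥0∞) / 2 ^ (n : ℕ) =
      ∑' n : ℕ, ENNReal.ofReal ((d n.succPNat : ℝ) / 2 ^ (n + 1)) := by
    rw [← Equiv.pnatEquivNat.symm.tsum_eq]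
    exact tsum_congr hdiv
  have hrec : IsRecurrent μ X 0 ↔ ∑' n : ℕ+, (d n : ℝ≥0∞) / 2 ^ (n : ℕ) = ∞ := by
    simp_rw [IsRecurrent, hret]
    rw [hsum, Hypercube.tsum_ofReal_eq_top_iff fun t => measureReal_nonneg,
      Hypercube.tsum_ofReal_eq_top_iff fun n => by positivity,
      Hypercube.summable_returnProb_iff (Hypercube.exists_lt_T hd) hX]
  have htrans : IsTransient μ X 0 ↔ ¬ IsRecurrent μ X 0 := by
    rw [IsTransient, IsRecurrent, tsum_eq_zero_add' ENNReal.summable, ENNReal.add_lt_top,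
      lt_top_iff_ne_top, lt_top_iff_ne_top]
    -- The two series differ only in the finite term at time `0`.
    exact and_iff_right (measure_ne_top _ _)
  exact ⟨hrec, by rw [htrans, hrec, lt_top_iff_ne_top]⟩
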